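/- **Biasing robust coin-flipping protocols.** All logarithms are base $2$. For an integer $n\ge 3$ let $\varepsilon=\varepsilon(n):=1/\sqrt[50]{\log\log n}$, $\lambda:=100/\varepsilon^{5}$ and $\delta:=1/\log^2 n$. An $n$-party full-information coin-flipping protocol $\Pi$ with $\ell$ rounds proceeds as follows: in each round a single party, determined by the messages broadcast so far, broadcasts a message drawn from a discrete distribution determined by the messages broadcast so far, and the common output is a Boolean function of the full transcript. Let $M=(M_1,\dots,M_\ell)$ be the transcript of a random honest execution. For a partial transcript $m_{\le i}$ let $\Pi(m_{\le i})$ be the expected output conditioned on $M_{\le i}=m_{\le i}$, let $\mathrm{jump}(m_{\le i}):=\Pi(m_{\le i})-\Pi(m_{<i})$, and let $\mathbb E[\Pi]$ be the expected output. The protocol is *$n$-robust* if $$\Pr\Big[\exists i\in\{1,\dots,\ell\}:\ \mathrm{Supp}\big(\mathrm{jump}(M_{\le i})\mid M_{<i}\big)\cap\big(-\infty,-\tfrac{1}{\lambda\sqrt n}\big]\neq\emptyset\Big]\le\delta .$$ A *$t$-adaptive adversary* is a computationally unbounded, possibly randomized, algorithm that sees all messages. Before each round it may add the party about to speak to its list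 of corrupted parties, whose size never exceeds $t$. In every round in which a corrupted party speaks, the adversary chooses the message, which must lie in the support of the honest message distribution of that round. Let $\mathbb E[\Pi_A]$ be the expected output of $\Pi$ when attacked by $A$. **Theorem.** There are absolute constants $c_1,c_2>0$ such that for every $n\ge 3$ and every $n$-party, $n$-robust full-information coin-flipping protocol $\Pi$ (of any number of rounds) with $\mathbb E[\Pi]\ge\varepsilon$, there is a $t$-adaptive adversary $A$ for $\Pi$, for some integer $t\le c_1\sqrt n\,\log n$, with $\mathbb E[\Pi_A]\ge 1-c_2\,\varepsilon$. -/

import Mathlib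

/-- A full-information coin-flipping protocol between `n` parties with messages in `M`.
There are `rounds` rounds; a (partial) transcript is the list of the messages broadcast so far, in
chronological order.  After the transcript `h`, the single party `speaker h` broadcasts a fresh
message drawn from the discrete law `next h` (parties are stateless), and the common output is the
Boolean function `output` of the full transcript. -/
structure CoinFlipProtocol (n : ℕ) (M : Type*) where
  rounds : ℕ
  speaker : List M → Fin n
  next : List M → PMF M
  output : List M → Bool

namespace CoinFlipProtocol

variable {n : ℕ} {M : Type*}

/-- The law of the transcript obtained by continuing the honest execution for `k` more rounds,
starting from the partial transcript `h`. -/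
noncomputable def runFrom (P : CoinFlipProtocol n M) : ℕ → List M → PMF (List M)
  | 0, h => PMF.pure h
  | k + 1, h => (P.next h).bind fun m => runFrom P k (h ++ [m])

/-- The law of the full transcript of a random honest execution. -/
noncomputable def transcript (P : CoinFlipProtocol n M) : PMF (List M) :=
  P.runFrom P.rounds []

/-- `Π(h)`: the expected outcome given the partial transcript `h`. -/
noncomputable def value (P : CoinFlipProtocol n M) (h : List M) : ℝ :=
  (((P.runFrom (P.rounds - h.length) h).map P.output) true).toReal

/-- `E[Π]`: the expected outcome of an honest execution. -/
noncomputable def expectedOutcome (P : CoinFlipProtocol n M) : ℝ :=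
  P.value []

/-- The increment in the expected outcome caused by the message `m` sent after `h`. -/
noncomputable def jump (P : CoinFlipProtocol n M) (h : List M) (m : M) : ℝ :=
  P.value (h ++ [m]) - P.value h

/-- The support of the jump caused by the next message, conditioned on the partial transcript
`h`. -/
def jumpSupport (P : CoinFlipProtocol n M) (h : List M) : Set ℝ :=
  {x | ∃ m ∈ (P.next h).support, x = P.jump h m}

end CoinFlipProtocol

/-- `ε = 1 / (log log n)^(1/50)`, logarithms in base two. -/
noncomputable def coinEps (n : ℕ) : ℝ :=
  1 / (Real.logb 2 (Real.logb 2 (n : ℝ))) ^ ((1 : ℝ) / 50)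

/-- `λ = 100 / ε^5`. -/
noncomputable def coinLambda (n : ℕ) : ℝ :=
  100 / coinEps n ^ 5

/-- `δ = 1 / log² n`, logarithm in base two. -/
noncomputable def coinDelta (n : ℕ) : ℝ :=
  1 / (Real.logb 2 (n : ℝ)) ^ 2

namespace CoinFlipProtocol

variable {p : ℕ} {M : Type*}

/-- `n`-robustness (towards `0`): in a random honest execution, the probability that some round
admits a jump of value at most `-1 / (λ √n)` is at most `δ`.  The number `p` of parties plays no
role in this definition. -/
def IsRobust (P : CoinFlipProtocol p M) (n : ℕ) : Prop :=
  (P.transcript.toOuterMeasure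
    {t | ∃ i < P.rounds,
      (P.jumpSupport (t.take i) ∩ Set.Iic (-(1 / (coinLambda n * Real.sqrt (n : ℝ))))).Nonempty}
    ).toReal ≤ coinDelta n

end CoinFlipProtocol

/-- An (unbounded, randomized) adaptive adversary for the protocol `P`.  It keeps a private memory
that may record all its past coins and decisions.
Before each round, knowing the transcript `h` so far, it tosses coins, updates its memory and
decides whether to corrupt the party that is about to speak (`decide`).  If the speaker is
corrupted (now or earlier), its message is drawn from the adversary's law `send`, which may only
produce valid messages, i.e. messages in the support of the honest law. -/
structure AdaptiveAdversary {n : ℕ} {M : Type*} (P : CoinFlipProtocol n M) where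
  Memory : Type
  init : Memory
  decide : List M → Memory → PMF (Bool × Memory)
  send : List M → Memory → PMF M
  send_valid : ∀ (h : List M) (s : Memory), (send h s).support ⊆ (P.next h).support

namespace AdaptiveAdversary

variable {n : ℕ} {M : Type*} {P : CoinFlipProtocol n M}

/-- A snapshot of an attacked execution: the transcript so far, the set of corrupted parties, and
the adversary's private memory. -/
structure Config (A : AdaptiveAdversary P) where
  history : List M
  corrupted : Finset (Fin n)
  memory : A.Memory

/-- One round of the attacked execution. -/
noncomputable def step (A : AdaptiveAdversary P) (c : A.Config) : PMF A.Config :=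
  (A.decide c.history c.memory).bind fun d =>
    let C : Finset (Fin n) :=
      if d.1 = true then insert (P.speaker c.history) c.corrupted else c.corrupted
    let law : PMF M :=
      if P.speaker c.history ∈ C then A.send c.history d.2 else P.next c.history
    law.map fun m => ⟨c.history ++ [m], C, d.2⟩

/-- The law of the snapshot after `k` rounds of the attacked execution. -/
noncomputable def play (A : AdaptiveAdversary P) : ℕ → PMF A.Config
  | 0 => PMF.pure ⟨[], ∅, A.init⟩
  | k + 1 => (play A k).bind A.step

/-- `A` is `t`-adaptive: its list of corrupted parties never exceeds `t`, in any possible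
execution.  (The list only grows, so it suffices to look at the end of the execution.) -/
def IsAdaptive (A : AdaptiveAdversary P) (t : ℕ) : Prop :=
  ∀ c ∈ (A.play P.rounds).support, c.corrupted.card ≤ t

/-- `E[Π_A]`: the expected outcome of the attacked execution. -/
noncomputable def expectedOutcome (A : AdaptiveAdversary P) : ℝ :=
  (((A.play P.rounds).map fun c => P.output c.history) true).toReal

end AdaptiveAdversary

/-! Fix `a = 1/ε²`, `q₀ = 1/√n`, `θ = 1/(λ√n)`. The target law multiplies the honest probability of
each message by `1 + a * jump` as long as no jump `≤ -θ` has been possible, and is honest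
afterwards. Jumps have mean zero, so this is a law. By `1 + x ≤ exp x` its density telescopes to at
most `exp (a * (value h - value []))`: transcripts with output `0` that avoid bad jumps have density
at most `exp (-a * E[Π])`, while those in the rare non-robust event have density at most `exp a`
(`tsum_density_output_false_le`).

The target law can be realised with few corruptions. A hidden random set of active parties is kept,
independent given the transcript. Before speaking, a party active with probability `x` is recruited
so that this becomes `y = max x q₀`. An active speaker tilts its message by `1 + (a / y) * jump`, an
inactive one is honest, and the mixture is the target tilt. Bayes' rule changes only the speaker's
probability, so independence persists (`le_play`). Nonnegativity of the tilt is ensured by `2aθ ≤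
q₀`.

The size of the active set is controlled by a supermartingale (`exists_affine_potential_bound`):
under the target law the value rises by `a E[jump²]` on average, which pays for the squared
fluctuations of the posteriors. The expected size is at most `(2 + a)√n`, so by Markov's inequality
truncating at `t ≈ √n log n` costs at most `(2 + a) / log n`. -/

open scoped ENNReal

/-- The law with a given mass function of total mass one. -/
noncomputable def pmfOfTsumEqOne {α : Type*} (f : α → ℝ≥0∞) (hf : ∑' x, f x = 1) : PMF α :=
  ⟨f, ENNReal.summable.hasSum_iff.2 hf⟩

theorem pmfOfTsumEqOne_apply {α : Type*} (f : α → ℝ≥0∞) (hf : ∑' x, f x = 1) (x : α) :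
    pmfOfTsumEqOne f hf x = f x :=
  rfl

namespace CoinFlipProtocol

variable {n : ℕ} {M : Type*} (P : CoinFlipProtocol n M)

/-! ### The value martingale -/

/-- The definition peels off the first round. Peeling off the last one instead matches `play` and
the recursions on reversed transcripts. -/
theorem runFrom_succ_eq_bind (k : ℕ) (h : List M) :
    P.runFrom (k + 1) h =
      (P.runFrom k h).bind fun h' => (P.next h').map fun m => h' ++ [m] := by
  induction k generalizing h with
  | zero => simp [runFrom, PMF.map, Function.comp_def]
  | succ k ih =>
    conv_lhs => rw [runFrom]
    simp_rw [ih]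
    rw [← PMF.bind_bind, ← runFrom, Nat.succ_eq_add_one, ih]

theorem length_of_mem_support_runFrom {k : ℕ} {h h' : List M}
    (hh : h' ∈ (P.runFrom k h).support) : h'.length = h.length + k := by
  induction k generalizing h with
  | zero => simp [runFrom] at hh; simp [hh]
  | succ k ih =>
    simp only [runFrom, PMF.mem_support_bind_iff] at hh
    obtain ⟨m, -, hm⟩ := hh
    have := ih hm
    simp at this
    omega

theorem length_of_runFrom_ne_zero {k : ℕ} {h : List M} (hh : P.runFrom k [] h ≠ 0) :
    h.length = k := by
  have := P.length_of_mem_support_runFrom ((PMF.mem_support_iff _ _).2 hh)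
  simpa using this

/-- Expectations over the transcript after `k + 1` rounds, conditioned on the first `k` rounds. -/
theorem tsum_runFrom_succ (k : ℕ) (F : List M → ℝ≥0∞) :
    ∑' h, P.runFrom (k + 1) [] h * F h =
      ∑' h, P.runFrom k [] h * ∑' m, P.next h m * F (h ++ [m]) := by
  classical
  rw [runFrom_succ_eq_bind]
  simp_rw [PMF.bind_apply, ← ENNReal.tsum_mul_right]
  rw [ENNReal.tsum_comm]
  congr 1
  ext h
  simp_rw [mul_assoc, ENNReal.tsum_mul_left]
  congr 1
  simp_rw [PMF.map_apply, ← ENNReal.tsum_mul_right]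
  rw [ENNReal.tsum_comm]
  congr 1
  ext m
  rw [tsum_eq_single (h ++ [m])]
  · simp
  · intro b hb
    simp [hb]

theorem runFrom_append_singleton (k : ℕ) (h : List M) (m : M) :
    P.runFrom (k + 1) [] (h ++ [m]) = P.runFrom k [] h * P.next h m := by
  classical
  have := P.tsum_runFrom_succ k (Pi.single (h ++ [m]) 1)
  rw [tsum_eq_single (h ++ [m]) (by intro b hb; simp [hb]),
    tsum_eq_single h, tsum_eq_single m] at this
  · simpa using this
  · intro b hb
    simp [hb]
  · intro b hb
    simp [hb]

theorem value_nonneg (h : List M) : 0 ≤ P.value h := ENNReal.toReal_nonneg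

theorem value_le_one (h : List M) : P.value h ≤ 1 :=
  ENNReal.toReal_mono ENNReal.one_ne_top (PMF.coe_le_one _ _)

theorem value_eq_zero_of_output_eq_false {h : List M} (hl : h.length = P.rounds)
    (ho : P.output h = false) : P.value h = 0 := by
  simp [value, hl, runFrom, PMF.pure_map, ho]

theorem hasSum_next_toReal (h : List M) : HasSum (fun m => (P.next h m).toReal) 1 := by
  have := ENNReal.hasSum_toReal (f := fun m => P.next h m) (by simp [PMF.tsum_coe])
  rwa [← ENNReal.tsum_toReal_eq (fun m => PMF.apply_ne_top _ _), PMF.tsum_coe,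
    ENNReal.toReal_one] at this

theorem hasSum_next_mul_value {h : List M} (hl : h.length < P.rounds) :
    HasSum (fun m => (P.next h m).toReal * P.value (h ++ [m])) (P.value h) := by
  obtain ⟨k, hk⟩ : ∃ k, P.rounds - h.length = k + 1 := ⟨P.rounds - h.length - 1, by omega⟩
  have hk' : P.rounds - (h.length + 1) = k := by omega
  have key : ((P.runFrom (P.rounds - h.length) h).map P.output) true =
      ∑' m, P.next h m * ((P.runFrom k (h ++ [m])).map P.output) true := by
    rw [hk, runFrom, PMF.map_bind, PMF.bind_apply]
  have hfin : ∑' m, P.next h m * ((P.runFrom k (h ++ [m])).map P.output) true ≠ ∞ := by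
    rw [← key]; exact PMF.apply_ne_top _ _
  have := ENNReal.hasSum_toReal hfin
  simp only [value, List.length_append, List.length_singleton, hk', key]
  rw [← ENNReal.tsum_toReal_eq (fun m => ENNReal.mul_ne_top
    (PMF.apply_ne_top _ _) (PMF.apply_ne_top _ _))] at this
  simpa only [ENNReal.toReal_mul] using this

/-- The expectation of an affine function of the jump: jumps have mean zero. -/
theorem tsum_next_mul_ofReal_affine {h : List M} (hl : h.length < P.rounds) (A B : ℝ)
    (hpos : ∀ m ∈ (P.next h).support, 0 ≤ A + B * P.jump h m) :
    ∑' m, P.next h m * ENNReal.ofReal (A + B * P.jump h m) = ENNReal.ofReal A := by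
  have h1 := P.hasSum_next_toReal h
  have h2 := P.hasSum_next_mul_value hl
  have h3 : HasSum (fun m => (P.next h m).toReal * (A + B * P.jump h m)) A := by
    have := (h1.mul_left (A - B * P.value h)).add (h2.mul_left B)
    have e : (A - B * P.value h) * 1 + B * P.value h = A := by ring
    rw [e] at this
    refine this.congr_fun fun m => ?_
    simp only [jump]
    ring
  have h4 : ∀ m, 0 ≤ (P.next h m).toReal * (A + B * P.jump h m) := fun m => by
    by_cases hm : m ∈ (P.next h).support
    · exact mul_nonneg ENNReal.toReal_nonneg (hpos m hm)
    · rw [PMF.mem_support_iff, not_not] at hm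
      simp [hm]
  conv_rhs => rw [← h3.tsum_eq, ENNReal.ofReal_tsum_of_nonneg h4 h3.summable]
  refine tsum_congr fun m => ?_
  rw [ENNReal.ofReal_mul ENNReal.toReal_nonneg, ENNReal.ofReal_toReal (PMF.apply_ne_top _ _)]

open Classical in
/-- The honest law of the next message reweighted by `1 + b * jump`, when this is a law. -/
noncomputable def tilt (h : List M) (b : ℝ) : PMF M :=
  if H : ∑' m, P.next h m * ENNReal.ofReal (1 + b * P.jump h m) = 1 then
    pmfOfTsumEqOne _ H
  else P.next h

theorem tilt_support (h : List M) (b : ℝ) : (P.tilt h b).support ⊆ (P.next h).support := by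
  intro m hm
  rw [PMF.mem_support_iff] at hm ⊢
  unfold tilt at hm
  split_ifs at hm with H
  · exact left_ne_zero_of_mul hm
  · exact hm

theorem tilt_apply {h : List M} {b : ℝ} (hl : h.length < P.rounds)
    (hpos : ∀ m ∈ (P.next h).support, 0 ≤ 1 + b * P.jump h m) (m : M) :
    P.tilt h b m = P.next h m * ENNReal.ofReal (1 + b * P.jump h m) := by
  have H := P.tsum_next_mul_ofReal_affine hl 1 b hpos
  rw [ENNReal.ofReal_one] at H
  unfold tilt
  rw [dif_pos H, pmfOfTsumEqOne_apply]

end CoinFlipProtocol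

/-! ### Independent random subsets -/

/-- The probability that the random subset containing each `j` independently with probability
`q j` equals `B`. -/
noncomputable def bernoulliWeight {ι : Type*} [Fintype ι] [DecidableEq ι] (q : ι → ℝ)
    (B : Finset ι) : ℝ :=
  (∏ j ∈ B, q j) * ∏ j ∈ Bᶜ, (1 - q j)

section BernoulliWeight

variable {ι : Type*} [Fintype ι] [DecidableEq ι] {q : ι → ℝ}

theorem bernoulliWeight_nonneg (h0 : ∀ j, 0 ≤ q j) (h1 : ∀ j, q j ≤ 1) (B : Finset ι) :
    0 ≤ bernoulliWeight q B :=
  mul_nonneg (Finset.prod_nonneg fun j _ => h0 j)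
    (Finset.prod_nonneg fun j _ => sub_nonneg.2 (h1 j))

theorem sum_bernoulliWeight (q : ι → ℝ) : ∑ B, bernoulliWeight q B = 1 := by
  have := Fintype.prod_add q (fun j => 1 - q j)
  simpa [bernoulliWeight] using this.symm

theorem sum_bernoulliWeight_mem (q : ι → ℝ) (i : ι) :
    ∑ B with i ∈ B, bernoulliWeight q B = q i := by
  -- Setting the absence weight of `i` to zero kills exactly the subsets that miss `i` in the
  -- expanded product.
  have h := Fintype.prod_add q (Function.update (fun j => 1 - q j) i 0)
  have hl : ∏ j, (q j + Function.update (fun j => 1 - q j) i 0 j) = q i := by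
    rw [Finset.prod_eq_single i]
    · simp
    · intro b _ hb; simp [hb]
    · simp
  rw [← hl, h, Finset.sum_filter]
  refine Finset.sum_congr rfl fun B _ => ?_
  split_ifs with hi
  · unfold bernoulliWeight
    congr 1
    refine Finset.prod_congr rfl fun j hj => ?_
    have : j ≠ i := by rintro rfl; simp [hi] at hj
    simp [this]
  · rw [Finset.prod_eq_zero (i := i) (s := Bᶜ) (by simpa using hi) (by simp), mul_zero]

theorem sum_bernoulliWeight_mul_card (q : ι → ℝ) :
    ∑ B, bernoulliWeight q B * (B.card : ℝ) = ∑ i, q i := by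
  have : ∀ B : Finset ι, bernoulliWeight q B * (B.card : ℝ) =
      ∑ i, if i ∈ B then bernoulliWeight q B else 0 := fun B => by
    simp [mul_comm]
  simp_rw [this]
  rw [Finset.sum_comm]
  refine Finset.sum_congr rfl fun i _ => ?_
  rw [← Finset.sum_filter, sum_bernoulliWeight_mem]

/-- Markov's inequality for the size of a random subset. -/
theorem one_sub_le_sum_bernoulliWeight (h0 : ∀ j, 0 ≤ q j) (h1 : ∀ j, q j ≤ 1) (t : ℕ) :
    1 - (∑ i, q i) / (t + 1) ≤ ∑ B with B.card ≤ t, bernoulliWeight q B := by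
  have hs := Finset.sum_filter_add_sum_filter_not Finset.univ (fun B : Finset ι => B.card ≤ t)
    (bernoulliWeight q)
  rw [sum_bernoulliWeight] at hs
  have ht : (0 : ℝ) < t + 1 := by positivity
  have : (∑ B with ¬ B.card ≤ t, bernoulliWeight q B) * (t + 1) ≤ ∑ i, q i := by
    rw [← sum_bernoulliWeight_mul_card, Finset.sum_mul, Finset.sum_filter]
    refine Finset.sum_le_sum fun B _ => ?_
    have hB := bernoulliWeight_nonneg h0 h1 B
    split_ifs with hc
    · positivity
    · refine mul_le_mul_of_nonneg_left ?_ hB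
      exact_mod_cast (by omega : t + 1 ≤ B.card)
  have := (le_div_iff₀ ht).2 this
  linarith

/-- The cofactor does not involve coordinate `i`, so weights before and after an update, and those
of `B` and `B.erase i`, can be compared through one common factor. -/
theorem bernoulliWeight_update_of_mem {i : ι} {B : Finset ι} (hi : i ∈ B) (x : ℝ) :
    bernoulliWeight (Function.update q i x) B =
      x * ((∏ j ∈ B.erase i, q j) * ∏ j ∈ Bᶜ, (1 - q j)) := by
  unfold bernoulliWeight
  rw [← Finset.mul_prod_erase B _ hi, Function.update_self, mul_assoc]
  congr 2
  · refine Finset.prod_congr rfl fun j hj => ?_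
    rw [Function.update_of_ne (Finset.ne_of_mem_erase hj)]
  · refine Finset.prod_congr rfl fun j hj => ?_
    rw [Function.update_of_ne]
    rintro rfl
    simp [hi] at hj

theorem bernoulliWeight_update_of_notMem {i : ι} {B : Finset ι} (hi : i ∉ B) (x : ℝ) :
    bernoulliWeight (Function.update q i x) B =
      (1 - x) * ((∏ j ∈ B, q j) * ∏ j ∈ Bᶜ.erase i, (1 - q j)) := by
  have hi' : i ∈ Bᶜ := by simpa using hi
  unfold bernoulliWeight
  rw [← Finset.mul_prod_erase Bᶜ _ hi', Function.update_self, mul_left_comm]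
  congr 2
  · refine Finset.prod_congr rfl fun j hj => ?_
    rw [Function.update_of_ne]
    rintro rfl
    exact hi hj
  · refine Finset.prod_congr rfl fun j hj => ?_
    rw [Function.update_of_ne (Finset.ne_of_mem_erase hj)]

theorem bernoulliWeight_of_mem {i : ι} {B : Finset ι} (hi : i ∈ B) :
    bernoulliWeight q B = q i * ((∏ j ∈ B.erase i, q j) * ∏ j ∈ Bᶜ, (1 - q j)) := by
  simpa using bernoulliWeight_update_of_mem (q := q) hi (q i)

theorem bernoulliWeight_of_notMem {i : ι} {B : Finset ι} (hi : i ∉ B) :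
    bernoulliWeight q B = (1 - q i) * ((∏ j ∈ B, q j) * ∏ j ∈ Bᶜ.erase i, (1 - q j)) := by
  simpa using bernoulliWeight_update_of_notMem (q := q) hi (q i)

theorem bernoulliWeight_erase {i : ι} {B : Finset ι} (hi : i ∈ B) :
    bernoulliWeight q (B.erase i) =
      (1 - q i) * ((∏ j ∈ B.erase i, q j) * ∏ j ∈ Bᶜ, (1 - q j)) := by
  rw [bernoulliWeight_of_notMem (Finset.notMem_erase i B), Finset.compl_erase,
    Finset.erase_insert (by simpa using hi)]

end BernoulliWeight

namespace CoinFlipProtocol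

variable {n : ℕ} {M : Type*} (P : CoinFlipProtocol n M)

/-! ### The target law

On the nodes all of whose prefixes have no jump `≤ -θ`, the target law reweights the honest law of
the next message by `1 + a * jump`.  It is realised by a random set of active parties: given the
transcript `h`, the parties are independently active with probabilities `posterior h`. -/

/-- There is still a message to be sent, and no jump `≤ -θ` was possible up to now. -/
def Attackable (θ : ℝ) (h : List M) : Prop :=
  h.length < P.rounds ∧
    ∀ i ≤ h.length, ¬ (P.jumpSupport (h.take i) ∩ Set.Iic (-θ)).Nonempty

open Classical in
/-- The factor of the jump in the reweighting of the next message under the target law. -/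
noncomputable def drift (a θ : ℝ) (h : List M) : ℝ :=
  if P.Attackable θ h then a else 0

/-- The density of the target law with respect to the honest law, by recursion on the reversed
transcript. -/
noncomputable def densityRev (a θ : ℝ) : List M → ℝ≥0∞
  | [] => 1
  | m :: l => densityRev a θ l * ENNReal.ofReal (1 + P.drift a θ l.reverse * P.jump l.reverse m)

/-- The density of the target law with respect to the honest law. -/
noncomputable def density (a θ : ℝ) (h : List M) : ℝ≥0∞ :=
  P.densityRev a θ h.reverse

open Classical in
/-- The probability that the next speaker is active, when it was active with probability `x`
before the adversary tossed its coin. -/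
noncomputable def raise (q₀ θ : ℝ) (h : List M) (x : ℝ) : ℝ :=
  if P.Attackable θ h then max x q₀ else x

open Classical in
/-- The posterior probability that the speaker is active once the message `m` is seen. -/
noncomputable def bayes (a q₀ θ : ℝ) (h : List M) (m : M) (x : ℝ) : ℝ :=
  if P.Attackable θ h ∧ m ∈ (P.next h).support then
    (max x q₀ + a * P.jump h m) / (1 + a * P.jump h m)
  else x

/-- The posterior probabilities of being active, by recursion on the reversed transcript. -/
noncomputable def posteriorRev (a q₀ θ : ℝ) : List M → Fin n → ℝ
  | [] => 0
  | m :: l =>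
    Function.update (posteriorRev a q₀ θ l) (P.speaker l.reverse)
      (P.bayes a q₀ θ l.reverse m (posteriorRev a q₀ θ l (P.speaker l.reverse)))

/-- The posterior probabilities of being active, given the transcript. -/
noncomputable def posterior (a q₀ θ : ℝ) (h : List M) : Fin n → ℝ :=
  P.posteriorRev a q₀ θ h.reverse

/-- The probability that the speaker is active, just before it sends its message. -/
noncomputable def activity (a q₀ θ : ℝ) (h : List M) : ℝ :=
  P.raise q₀ θ h (P.posterior a q₀ θ h (P.speaker h))

open Classical in
/-- The factor of the jump in the reweighting of the message of an active speaker. -/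
noncomputable def bias (a q₀ θ : ℝ) (h : List M) : ℝ :=
  if P.Attackable θ h then a / P.activity a q₀ θ h else 0

variable {P} {a q₀ θ : ℝ}

theorem density_nil : P.density a θ [] = 1 := rfl

theorem density_append (h : List M) (m : M) :
    P.density a θ (h ++ [m]) =
      P.density a θ h * ENNReal.ofReal (1 + P.drift a θ h * P.jump h m) := by
  simp [density, densityRev]

theorem posterior_nil : P.posterior a q₀ θ [] = 0 := rfl

theorem posterior_append (h : List M) (m : M) :
    P.posterior a q₀ θ (h ++ [m]) =
      Function.update (P.posterior a q₀ θ h) (P.speaker h)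
        (P.bayes a q₀ θ h m (P.posterior a q₀ θ h (P.speaker h))) := by
  simp [posterior, posteriorRev]

theorem Attackable.neg_lt_jump {h : List M} (hA : P.Attackable θ h) {m : M}
    (hm : m ∈ (P.next h).support) : -θ < P.jump h m := by
  by_contra! hc
  refine hA.2 h.length le_rfl ⟨P.jump h m, ?_, hc⟩
  rw [List.take_length]
  exact ⟨m, hm, rfl⟩

/-! ### Bounds on the density -/

theorem density_le_of_attackable {h : List M}
    (hA : ∀ i < h.length, P.Attackable θ (h.take i)) :
    P.density a θ h ≤ ENNReal.ofReal (Real.exp (a * (P.value h - P.value []))) := by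
  induction h using List.reverseRecOn with
  | nil => simp [density_nil]
  | append_singleton h m ih =>
    have hh : P.Attackable θ h := by
      simpa using hA h.length (by simp)
    have ih' := ih fun i hi => by
      have := hA i (by simp; omega)
      rwa [List.take_append_of_le_length hi.le] at this
    have hd : P.drift a θ h = a := if_pos hh
    rw [density_append, hd]
    have he : Real.exp (a * (P.value (h ++ [m]) - P.value [])) =
        Real.exp (a * (P.value h - P.value [])) * Real.exp (a * P.jump h m) := by
      rw [← Real.exp_add]
      congr 1
      simp only [jump]
      ring
    rw [he, ENNReal.ofReal_mul (Real.exp_nonneg _)]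
    refine mul_le_mul' ih' (ENNReal.ofReal_le_ofReal ?_)
    linarith [Real.add_one_le_exp (a * P.jump h m)]

/-- Once a node is not attackable, neither are its extensions, so the density is frozen there; up to
that point the telescoped exponent is at most `a`. -/
theorem density_le_exp (ha : 0 ≤ a) (h : List M) :
    P.density a θ h ≤ ENNReal.ofReal (Real.exp a) := by
  have key : ∀ h : List M, (∀ i < h.length, P.Attackable θ (h.take i)) →
      P.density a θ h ≤ ENNReal.ofReal (Real.exp a) := fun h hh => by
    refine (density_le_of_attackable hh).trans (ENNReal.ofReal_le_ofReal (Real.exp_le_exp.2 ?_))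
    nlinarith [P.value_le_one h, P.value_nonneg []]
  induction h using List.reverseRecOn with
  | nil => exact key [] (by simp)
  | append_singleton h m ih =>
    by_cases hh : P.Attackable θ h
    · refine key _ fun i hi => ?_
      have hi' : i ≤ h.length := by simp at hi; omega
      rw [List.take_append_of_le_length hi']
      refine ⟨by have := hh.1; rw [List.length_take]; omega, fun j hj => ?_⟩
      rw [List.length_take] at hj
      rw [List.take_take, min_eq_left (by omega)]
      exact hh.2 j (by omega)
    · have hd : P.drift a θ h = 0 := if_neg hh
      rw [density_append, hd]
      simpa using ih

/-- The parameters of an attack on nodes without jumps `≤ -θ`, with reweighting factor `a` and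
initial activity `q₀`. -/
structure AttackParameters (a q₀ θ : ℝ) : Prop where
  pos : 0 < a
  initial_pos : 0 < q₀
  initial_le_one : q₀ ≤ 1
  mul_le : 2 * a * θ ≤ q₀

theorem AttackParameters.half_le (hp : AttackParameters a q₀ θ) {h : List M}
    (hA : P.Attackable θ h) {m : M} (hm : m ∈ (P.next h).support) :
    -(q₀ / 2) ≤ a * P.jump h m := by
  nlinarith [hA.neg_lt_jump hm, hp.pos, hp.mul_le]

/-- In `(y + a * jump) / (1 + a * jump)` the numerator is nonnegative because `y ≥ q₀` and `a * jump
≥ -q₀ / 2`, and it is at most the denominator because `y ≤ 1`. -/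
theorem posterior_mem (hp : AttackParameters a q₀ θ) (h : List M) (j : Fin n) :
    0 ≤ P.posterior a q₀ θ h j ∧ P.posterior a q₀ θ h j ≤ 1 := by
  induction h using List.reverseRecOn with
  | nil => simp [posterior_nil]
  | append_singleton h m ih =>
    rw [posterior_append]
    by_cases hj : j = P.speaker h
    · subst hj
      rw [Function.update_self]
      unfold bayes
      split_ifs with hc
      · have h1 := hp.half_le hc.1 hc.2
        have h2 := hp.initial_le_one
        have h3 := hp.initial_pos
        have h4 := le_max_right (P.posterior a q₀ θ h (P.speaker h)) q₀
        have h5 : max (P.posterior a q₀ θ h (P.speaker h)) q₀ ≤ 1 := max_le ih.2 h2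
        have h6 : 0 < 1 + a * P.jump h m := by linarith
        exact ⟨div_nonneg (by linarith) h6.le, (div_le_one h6).2 (by linarith)⟩
      · exact ih
    · rw [Function.update_of_ne hj]
      exact ih

theorem posterior_le_activity (h : List M) :
    P.posterior a q₀ θ h (P.speaker h) ≤ P.activity a q₀ θ h := by
  unfold activity raise
  split_ifs
  · exact le_max_left _ _
  · exact le_rfl

theorem activity_le_one (hp : AttackParameters a q₀ θ) (h : List M) :
    P.activity a q₀ θ h ≤ 1 := by
  have := (posterior_mem (P := P) hp h (P.speaker h)).2
  unfold activity raise
  split_ifs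
  · exact max_le this hp.initial_le_one
  · exact this

theorem le_activity {h : List M} (hA : P.Attackable θ h) : q₀ ≤ P.activity a q₀ θ h := by
  unfold activity raise
  rw [if_pos hA]
  exact le_max_right _ _

/-- This is what makes the mixture of an active (tilted) and an inactive (honest) speaker equal to
the target law. -/
theorem activity_mul_bias (hp : AttackParameters a q₀ θ) (h : List M) :
    P.activity a q₀ θ h * P.bias a q₀ θ h = P.drift a θ h := by
  unfold bias drift
  split_ifs with hA
  · have := hp.initial_pos.trans_le (le_activity (a := a) (q₀ := q₀) hA)
    field_simp
  · simp

theorem half_le_one_add_drift (hp : AttackParameters a q₀ θ) {h : List M} {m : M}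
    (hm : m ∈ (P.next h).support) : 1 / 2 ≤ 1 + P.drift a θ h * P.jump h m := by
  unfold drift
  split_ifs with hA
  · linarith [hp.half_le hA hm, hp.initial_le_one]
  · norm_num

theorem one_add_bias_nonneg (hp : AttackParameters a q₀ θ) {h : List M} {m : M}
    (hm : m ∈ (P.next h).support) : 0 ≤ 1 + P.bias a q₀ θ h * P.jump h m := by
  unfold bias
  split_ifs with hA
  · have h1 := le_activity (a := a) (q₀ := q₀) hA
    have h2 := hp.initial_pos
    have h3 : 0 < P.activity a q₀ θ h := h2.trans_le h1
    have : 1 + a / P.activity a q₀ θ h * P.jump h m =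
        (P.activity a q₀ θ h + a * P.jump h m) / P.activity a q₀ θ h := by
      field_simp
    rw [this]
    exact div_nonneg (by linarith [hp.half_le hA hm]) h3.le
  · norm_num

/-- Bayes' rule for the activity of the speaker. -/
theorem one_add_drift_mul_bayes (hp : AttackParameters a q₀ θ) {h : List M} {m : M}
    (hm : m ∈ (P.next h).support) :
    (1 + P.drift a θ h * P.jump h m) *
        P.bayes a q₀ θ h m (P.posterior a q₀ θ h (P.speaker h)) =
      P.activity a q₀ θ h * (1 + P.bias a q₀ θ h * P.jump h m) := by
  have h1 := half_le_one_add_drift hp hm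
  rw [mul_add, mul_one, ← mul_assoc, activity_mul_bias hp]
  unfold drift at h1 ⊢
  unfold bayes activity raise
  by_cases hA : P.Attackable θ h
  · rw [if_pos hA] at h1
    rw [if_pos hA, if_pos ⟨hA, hm⟩, if_pos hA]
    rw [mul_div_cancel₀]
    linarith
  · simp [hA]

/-! ### The size of the attack -/

/-- A supermartingale under the target law, which bounds the number of active parties. -/
noncomputable def potential (P : CoinFlipProtocol n M) (a q₀ θ : ℝ) (h : List M) : ℝ :=
  ∑ j, (P.posterior a q₀ θ h j - q₀) ^ 2 + 2 * a * (1 - P.value h)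

theorem potential_nonneg (ha : 0 ≤ a) (h : List M) : 0 ≤ P.potential a q₀ θ h := by
  have := P.value_le_one h
  have : 0 ≤ 2 * a * (1 - P.value h) := by
    have : 0 ≤ 1 - P.value h := by linarith
    positivity
  have : 0 ≤ ∑ j, (P.posterior a q₀ θ h j - q₀) ^ 2 := Finset.sum_nonneg fun j _ => sq_nonneg _
  unfold potential
  linarith

/-- An affine function of the jump has honest mean `A`, so this is the one-step supermartingale
inequality. Raising the activity to `max x q₀` only lowers the squared deviation; the quadratic term
of the Bayes update is at most `2 * (a * jump) ^ 2`, which the value term of the potential cancels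
exactly. -/
theorem exists_affine_potential_bound (hp : AttackParameters a q₀ θ) (h : List M) :
    ∃ A B : ℝ, A ≤ P.potential a q₀ θ h ∧ ∀ m ∈ (P.next h).support,
      (1 + P.drift a θ h * P.jump h m) * P.potential a q₀ θ (h ++ [m]) ≤ A + B * P.jump h m := by
  set s := P.speaker h
  set q := P.posterior a q₀ θ h
  have hsum : ∀ m, ∑ j, (P.posterior a q₀ θ (h ++ [m]) j - q₀) ^ 2 =
      (P.bayes a q₀ θ h m (q s) - q₀) ^ 2 + ∑ j ∈ Finset.univ.erase s, (q j - q₀) ^ 2 := by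
    intro m
    rw [← Finset.add_sum_erase _ _ (Finset.mem_univ s), posterior_append, Function.update_self]
    congr 1
    refine Finset.sum_congr rfl fun j hj => ?_
    rw [Function.update_of_ne (Finset.ne_of_mem_erase hj)]
  have hsum' : ∑ j, (q j - q₀) ^ 2 =
      (q s - q₀) ^ 2 + ∑ j ∈ Finset.univ.erase s, (q j - q₀) ^ 2 :=
    (Finset.add_sum_erase _ _ (Finset.mem_univ s)).symm
  set R := ∑ j ∈ Finset.univ.erase s, (q j - q₀) ^ 2
  set X := P.value h
  have hval : ∀ m, P.value (h ++ [m]) = X + P.jump h m := fun m => by simp [jump, X]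
  unfold potential
  simp_rw [hsum, hval]
  rw [hsum']
  by_cases hA : P.Attackable θ h
  · have hd : P.drift a θ h = a := if_pos hA
    set y := max (q s) q₀
    have hy : (y - q₀) ^ 2 ≤ (q s - q₀) ^ 2 := by
      rcases le_total (q s) q₀ with hq | hq
      · rw [show y = q₀ from max_eq_right hq, sub_self, zero_pow two_ne_zero]
        exact sq_nonneg _
      · simp [y, max_eq_left hq]
    have hy0 : 0 ≤ y := hp.initial_pos.le.trans (le_max_right _ _)
    have hy1 : y ≤ 1 := max_le (posterior_mem hp h s).2 hp.initial_le_one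
    -- The constant and linear coefficients in the jump, once the quadratic terms have cancelled.
    refine ⟨(y - q₀) ^ 2 + R + 2 * a * (1 - X),
      a * (y - q₀) ^ 2 + 2 * (y - q₀) * a * (1 - y) + a * R
        + a * (2 * a * (1 - X)) - 2 * a, by linarith, fun m hm => ?_⟩
    have hb : P.bayes a q₀ θ h m (q s) =
        (y + a * P.jump h m) / (1 + a * P.jump h m) := if_pos ⟨hA, hm⟩
    have h1 := half_le_one_add_drift hp hm
    rw [hb]
    rw [hd] at h1 ⊢
    set J := P.jump h m
    have h2 : 0 < 1 + a * J := by linarith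
    have e : (1 + a * J) * ((y + a * J) / (1 + a * J) - q₀) ^ 2 =
        (1 + a * J) * (y - q₀) ^ 2 + 2 * (y - q₀) * (a * (1 - y) * J) +
          (a * (1 - y) * J) ^ 2 / (1 + a * J) := by
      field_simp
      ring
    -- The factor `2` comes from `1 + a * J ≥ 1 / 2`.
    have h3 : (a * (1 - y) * J) ^ 2 / (1 + a * J) ≤ 2 * (a * J) ^ 2 := by
      rw [div_le_iff₀ h2]
      have h4 : (1 - y) ^ 2 ≤ 1 := by nlinarith
      have h5 : (a * (1 - y) * J) ^ 2 ≤ (a * J) ^ 2 := by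
        have : (a * (1 - y) * J) ^ 2 = (1 - y) ^ 2 * (a * J) ^ 2 := by ring
        rw [this]
        exact mul_le_of_le_one_left (sq_nonneg _) h4
      nlinarith [sq_nonneg (a * J)]
    linarith
  · have hd : P.drift a θ h = 0 := if_neg hA
    refine ⟨(q s - q₀) ^ 2 + R + 2 * a * (1 - X), - (2 * a), le_rfl, fun m _ => ?_⟩
    have hb : P.bayes a q₀ θ h m (q s) = q s := if_neg fun hc => hA hc.1
    rw [hb, hd]
    linarith

/-! ### Expectations under the target law -/

theorem tsum_density (hp : AttackParameters a q₀ θ) {k : ℕ} (hk : k ≤ P.rounds) :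
    ∑' h, P.runFrom k [] h * P.density a θ h = 1 := by
  induction k with
  | zero =>
    rw [tsum_eq_single []]
    · simp [runFrom, density_nil]
    · intro h hh
      simp [runFrom, hh]
  | succ k ih =>
    rw [tsum_runFrom_succ, ← ih (by omega)]
    refine tsum_congr fun h => ?_
    by_cases hh : P.runFrom k [] h = 0
    · simp [hh]
    · have hl := P.length_of_runFrom_ne_zero hh
      have := P.tsum_next_mul_ofReal_affine (h := h) (by omega) 1 (P.drift a θ h) fun m hm => by
        linarith [half_le_one_add_drift (a := a) hp hm]
      simp_rw [density_append, mul_left_comm, ENNReal.tsum_mul_left, this]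
      simp

theorem tsum_density_mul_potential_le (hp : AttackParameters a q₀ θ) {k : ℕ}
    (hk : k ≤ P.rounds) :
    ∑' h, P.runFrom k [] h * (P.density a θ h * ENNReal.ofReal (P.potential a q₀ θ h)) ≤
      ENNReal.ofReal (n * q₀ ^ 2 + 2 * a) := by
  induction k with
  | zero =>
    rw [tsum_eq_single []]
    · have := P.value_nonneg []
      have : 2 * a * (1 - P.value []) ≤ 2 * a := by nlinarith [hp.pos]
      simp only [runFrom, density_nil, PMF.pure_apply, if_true, one_mul]
      refine ENNReal.ofReal_le_ofReal ?_
      simpa [potential, posterior_nil] using this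
    · intro h hh
      simp [runFrom, hh]
  | succ k ih =>
    rw [tsum_runFrom_succ]
    refine le_trans (ENNReal.tsum_le_tsum fun h => ?_) (ih (by omega))
    by_cases hh : P.runFrom k [] h = 0
    · simp [hh]
    have hl := P.length_of_runFrom_ne_zero hh
    obtain ⟨A, B, hA, hB⟩ := exists_affine_potential_bound (P := P) hp h
    have hpos : ∀ m ∈ (P.next h).support, 0 ≤ A + B * P.jump h m := fun m hm =>
      le_trans (mul_nonneg (by linarith [half_le_one_add_drift (a := a) hp hm])
        (potential_nonneg hp.pos.le _)) (hB m hm)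
    gcongr
    simp_rw [density_append, mul_assoc, mul_left_comm _ (P.density a θ h), ENNReal.tsum_mul_left]
    gcongr
    calc
      _ ≤ ∑' m, P.next h m * ENNReal.ofReal (A + B * P.jump h m) := by
        refine ENNReal.tsum_le_tsum fun m => ?_
        by_cases hm : m ∈ (P.next h).support
        · have := half_le_one_add_drift (a := a) hp hm
          rw [← ENNReal.ofReal_mul (by linarith)]
          gcongr
          exact hB m hm
        · rw [PMF.mem_support_iff, not_not] at hm
          simp [hm]
      _ = ENNReal.ofReal A := P.tsum_next_mul_ofReal_affine (by omega) A B hpos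
      _ ≤ _ := ENNReal.ofReal_le_ofReal hA

/-- Summing `(p - 2 * q₀) ^ 2 ≥ 0` over the posteriors `p` bounds them linearly by their squared
deviations from `q₀`. -/
theorem sum_posterior_le (hp : AttackParameters a q₀ θ) (hq : n * q₀ ^ 2 = 1) (h : List M) :
    ∑ j, P.posterior a q₀ θ h j ≤ (3 / 2 + P.potential a q₀ θ h / 2) / q₀ := by
  have hq0 := hp.initial_pos
  have hv : 0 ≤ 2 * a * (1 - P.value h) := by
    have := P.value_le_one h
    have := hp.pos
    have : 0 ≤ 1 - P.value h := by linarith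
    positivity
  have h1 : ∀ j, q₀ * P.posterior a q₀ θ h j ≤
      3 / 2 * q₀ ^ 2 + (P.posterior a q₀ θ h j - q₀) ^ 2 / 2 := fun j => by
    nlinarith [sq_nonneg (P.posterior a q₀ θ h j - 2 * q₀)]
  have h2 := Finset.sum_le_sum fun j (_ : j ∈ Finset.univ) => h1 j
  rw [Finset.sum_add_distrib, ← Finset.mul_sum, ← Finset.sum_div] at h2
  rw [Finset.sum_const, Finset.card_univ, Fintype.card_fin, nsmul_eq_mul] at h2
  rw [le_div_iff₀ hq0]
  unfold potential
  linarith

/-- The expected number of active parties under the target law. -/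
theorem tsum_density_mul_sum_posterior_le (hp : AttackParameters a q₀ θ) (hq : n * q₀ ^ 2 = 1) :
    ∑' h, P.transcript h * (P.density a θ h * ENNReal.ofReal (∑ j, P.posterior a q₀ θ h j)) ≤
      ENNReal.ofReal ((2 + a) / q₀) := by
  have hq0 := hp.initial_pos
  have ha := hp.pos
  calc
    _ ≤ ∑' h, (ENNReal.ofReal (3 / 2 / q₀) * (P.transcript h * P.density a θ h) +
        ENNReal.ofReal (1 / 2 / q₀) *
          (P.transcript h * (P.density a θ h * ENNReal.ofReal (P.potential a q₀ θ h)))) := by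
      refine ENNReal.tsum_le_tsum fun h => ?_
      have hpot := potential_nonneg (P := P) (q₀ := q₀) (θ := θ) ha.le h
      have h1 : ENNReal.ofReal (∑ j, P.posterior a q₀ θ h j) ≤
          ENNReal.ofReal (3 / 2 / q₀) +
            ENNReal.ofReal (1 / 2 / q₀) * ENNReal.ofReal (P.potential a q₀ θ h) := by
        rw [← ENNReal.ofReal_mul (by positivity), ← ENNReal.ofReal_add (by positivity)
          (by positivity)]
        refine ENNReal.ofReal_le_ofReal ((sum_posterior_le hp hq h).trans_eq ?_)
        ring
      refine (mul_le_mul_right (mul_le_mul_right h1 _) _).trans_eq ?_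
      ring
    _ ≤ ENNReal.ofReal (3 / 2 / q₀) * 1 +
        ENNReal.ofReal (1 / 2 / q₀) * ENNReal.ofReal (n * q₀ ^ 2 + 2 * a) := by
      rw [ENNReal.tsum_add, ENNReal.tsum_mul_left, ENNReal.tsum_mul_left]
      gcongr
      · exact (tsum_density hp le_rfl).le
      · exact tsum_density_mul_potential_le hp le_rfl
    _ = _ := by
      rw [mul_one, ← ENNReal.ofReal_mul (by positivity), hq, ← ENNReal.ofReal_add (by positivity)
        (by positivity)]
      congr 1
      ring

/-- Under the target law, the outcome `0` is unlikely. -/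
theorem tsum_density_output_false_le (hp : AttackParameters a q₀ θ) {δ : ℝ}
    (hδ : (P.transcript.toOuterMeasure
      {t | ∃ i < P.rounds,
        (P.jumpSupport (t.take i) ∩ Set.Iic (-θ)).Nonempty}).toReal ≤ δ) :
    ∑' h, (if P.output h = false then P.transcript h * P.density a θ h else 0) ≤
      ENNReal.ofReal (Real.exp (-(a * P.expectedOutcome)) + Real.exp a * δ) := by
  classical
  set E := {t : List M | ∃ i < P.rounds, (P.jumpSupport (t.take i) ∩ Set.Iic (-θ)).Nonempty}
  have hE : P.transcript.toOuterMeasure E ≤ ENNReal.ofReal δ := by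
    refine ENNReal.le_ofReal_iff_toReal_le ?_ (ENNReal.toReal_nonneg.trans hδ) |>.2 hδ
    refine ne_top_of_le_ne_top ENNReal.one_ne_top ?_
    rw [PMF.toOuterMeasure_apply, ← P.transcript.tsum_coe]
    exact ENNReal.tsum_le_tsum fun h => Set.indicator_le_self _ _ _
  have hδ0 : 0 ≤ δ := ENNReal.toReal_nonneg.trans hδ
  rw [ENNReal.ofReal_add (by positivity) (by positivity), ENNReal.ofReal_mul (by positivity)]
  calc
    _ ≤ ∑' h, (P.transcript h * ENNReal.ofReal (Real.exp (-(a * P.expectedOutcome))) +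
        ENNReal.ofReal (Real.exp a) * E.indicator P.transcript h) := by
      refine ENNReal.tsum_le_tsum fun h => ?_
      split_ifs with ho
      swap
      · exact zero_le
      by_cases hh : P.transcript h = 0
      · simp [hh]
      have hl : h.length = P.rounds := P.length_of_runFrom_ne_zero hh
      -- In the non-robust event the crude bound `exp a` is used; outside it every proper prefix is
      -- attackable and the final value is `0`.
      by_cases hhE : h ∈ E
      · rw [Set.indicator_of_mem hhE, mul_comm]
        exact le_add_left (mul_le_mul_left (density_le_exp hp.pos.le h) _)
      · refine le_add_right (mul_le_mul_right ?_ _)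
        have hA : ∀ i < h.length, P.Attackable θ (h.take i) := fun i hi =>
          ⟨by rw [List.length_take]; omega, fun j hj => by
            rw [List.length_take] at hj
            rw [List.take_take, min_eq_left (by omega)]
            exact fun hc => hhE ⟨j, by omega, hc⟩⟩
        refine (density_le_of_attackable hA).trans_eq ?_
        rw [P.value_eq_zero_of_output_eq_false hl ho]
        congr 2
        simp [expectedOutcome]
    _ ≤ _ := by
      rw [ENNReal.tsum_add, ENNReal.tsum_mul_left, ENNReal.tsum_mul_right, PMF.tsum_coe, one_mul,
        ← PMF.toOuterMeasure_apply]
      gcongr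

end CoinFlipProtocol

/-! ### The attack -/

-- Keeps only the coin outcomes leading to the prescribed corrupted set and memory, and only the
-- message `m`; a lower bound suffices for the attack.
open Classical in
theorem AdaptiveAdversary.le_step {n : ℕ} {M : Type*} {P : CoinFlipProtocol n M}
    (A : AdaptiveAdversary P) (h : List M) (m : M) (C C' : Finset (Fin n)) (s s' : A.Memory)
    (coin : PMF Bool) (g : Bool → Bool × A.Memory) (hd : A.decide h s = coin.map g) :
    ∑ b : Bool, coin b *
        (if (if (g b).1 = true then insert (P.speaker h) C else C) = C' ∧ (g b).2 = s' then
          (if P.speaker h ∈ C' then A.send h s' else P.next h) m else 0) ≤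
      A.step ⟨h, C, s⟩ ⟨h ++ [m], C', s'⟩ := by
  unfold AdaptiveAdversary.step
  dsimp only
  rw [hd, PMF.bind_map, PMF.bind_apply, tsum_fintype]
  refine Finset.sum_le_sum fun b _ => mul_le_mul_right ?_ _
  by_cases hb : (if (g b).1 = true then insert (P.speaker h) C else C) = C' ∧ (g b).2 = s'
  · rw [if_pos hb]
    obtain ⟨h1, h2⟩ := hb
    simp only [Function.comp_apply]
    have e : (if (g b).1 = true then insert (P.speaker h) C else C) = C' := by
      convert h1
    rw [e, h2, PMF.map_apply]
    refine le_trans ?_ (ENNReal.le_tsum m)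
    rw [if_pos rfl]
  · rw [if_neg hb]
    exact zero_le

namespace CoinFlipProtocol

variable {n : ℕ} {M : Type*} (P : CoinFlipProtocol n M) (a q₀ θ : ℝ) (t : ℕ)

/-- The probability that the adversary makes an inactive speaker active. -/
noncomputable def recruit (h : List M) : ℝ :=
  (P.activity a q₀ θ h - P.posterior a q₀ θ h (P.speaker h)) /
    (1 - P.posterior a q₀ θ h (P.speaker h))

variable {P a q₀ θ} in
theorem recruit_nonneg (hp : AttackParameters a q₀ θ) (h : List M) :
    0 ≤ P.recruit a q₀ θ h :=
  div_nonneg (sub_nonneg.2 (posterior_le_activity h))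
    (sub_nonneg.2 (posterior_mem hp h (P.speaker h)).2)

variable {P a q₀ θ} in
theorem recruit_le_one (hp : AttackParameters a q₀ θ) (h : List M) :
    P.recruit a q₀ θ h ≤ 1 :=
  div_le_one_of_le₀ (by linarith [activity_le_one (P := P) hp h])
    (sub_nonneg.2 (posterior_mem hp h (P.speaker h)).2)

-- Recruiting turns the probability `x` of being active into `x + (1 - x) * recruit`, which is the
-- activity. If `x = 1`, the quotient is `0 / 0 = 0` and nobody needs recruiting.
variable {P a q₀ θ} in
theorem one_sub_mul_recruit (hp : AttackParameters a q₀ θ) (h : List M) :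
    (1 - P.posterior a q₀ θ h (P.speaker h)) * P.recruit a q₀ θ h =
      P.activity a q₀ θ h - P.posterior a q₀ θ h (P.speaker h) := by
  unfold recruit
  have h1 := activity_le_one (P := P) hp h
  have h2 := posterior_le_activity (P := P) (a := a) (q₀ := q₀) (θ := θ) h
  rcases (posterior_mem (P := P) hp h (P.speaker h)).2.eq_or_lt with h3 | h3
  · rw [h3] at h2 ⊢
    rw [le_antisymm h1 h2]
    simp
  · exact mul_div_cancel₀ _ (by linarith)

/-- The coin by which the adversary decides whether to make an inactive speaker active. -/
noncomputable def recruitCoin (h : List M) : PMF Bool :=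
  pmfOfTsumEqOne
    (fun b => if b then min (ENNReal.ofReal (P.recruit a q₀ θ h)) 1
      else 1 - min (ENNReal.ofReal (P.recruit a q₀ θ h)) 1)
    (by simp)

/-- The decision of the adversary, whose active parties are those in `B`, when its coin shows `c`:
whether it corrupts the speaker, and the new set of active parties. -/
def attackMove (h : List M) (B : Finset (Fin n)) (c : Bool) : Bool × Finset (Fin n) :=
  let B' := if c then insert (P.speaker h) B else B
  (decide (P.speaker h ∈ B' ∧ B'.card ≤ t), B')

/-- The adversary realising the target law with at most `t` corruptions.  Its memory is the set of
active parties; an active speaker is corrupted as long as there are at most `t` of them. -/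
noncomputable def attack : AdaptiveAdversary P where
  Memory := Finset (Fin n)
  init := ∅
  decide h B := (P.recruitCoin a q₀ θ h).map (P.attackMove t h B)
  send h _ := P.tilt h (P.bias a q₀ θ h)
  send_valid h _ := P.tilt_support h _

/-- The corrupted set grows only when the active set, which contains it, has at most `t` elements.
-/
theorem attackMove_invariant {h : List M} {B C : Finset (Fin n)} (c : Bool) (hsub : C ⊆ B)
    (hcard : C.card ≤ t) :
    (if (P.attackMove t h B c).1 = true then insert (P.speaker h) C else C) ⊆
        (P.attackMove t h B c).2 ∧
      (if (P.attackMove t h B c).1 = true then insert (P.speaker h) C else C).card ≤ t := by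
  have hB' : C ⊆ if c = true then insert (P.speaker h) B else B := by
    split_ifs
    · exact hsub.trans (Finset.subset_insert _ _)
    · exact hsub
  obtain ⟨B', hB⟩ : ∃ B', (if c = true then insert (P.speaker h) B else B) = B' := ⟨_, rfl⟩
  rw [hB] at hB'
  simp only [attackMove, hB]
  split_ifs with hb
  · simp only [decide_eq_true_eq] at hb
    have := Finset.insert_subset hb.1 hB'
    exact ⟨this, (Finset.card_le_card this).trans hb.2⟩
  · exact ⟨hB', hcard⟩

theorem attackMove_of_card_le {h : List M} {B B' : Finset (Fin n)} {c : Bool}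
    (hB : (if c then insert (P.speaker h) B else B) = B') (ht : B'.card ≤ t) :
    (if (P.attackMove t h B c).1 = true then insert (P.speaker h) B else B) = B' ∧
      (P.attackMove t h B c).2 = B' := by
  refine ⟨?_, hB⟩
  simp only [attackMove, hB, ht, and_true, decide_eq_true_eq]
  subst hB
  by_cases hs : P.speaker h ∈ B <;> cases c <;> simp [hs]

theorem attack_isAdaptive : (P.attack a q₀ θ t).IsAdaptive t := by
  classical
  have key : ∀ k, ∀ c ∈ ((P.attack a q₀ θ t).play k).support,
      c.corrupted ⊆ c.memory ∧ c.corrupted.card ≤ t := by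
    intro k
    induction k with
    | zero =>
      intro c hc
      simp only [AdaptiveAdversary.play, PMF.support_pure, Set.mem_singleton_iff] at hc
      subst hc
      exact ⟨Finset.Subset.refl _, by simp⟩
    | succ k ih =>
      intro c hc
      simp only [AdaptiveAdversary.play, AdaptiveAdversary.step, PMF.mem_support_bind_iff,
        PMF.mem_support_map_iff] at hc
      obtain ⟨c₀, hc₀, d, hd, m, -, rfl⟩ := hc
      obtain ⟨b, -, rfl⟩ := (PMF.mem_support_map_iff _ _ _).1 hd
      exact P.attackMove_invariant t b (ih c₀ hc₀).1 (ih c₀ hc₀).2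
  exact fun c hc => (key _ c hc).2

/-- The snapshot in which exactly the active parties are corrupted. -/
noncomputable def exactConfig (h : List M) (B : Finset (Fin n)) : (P.attack a q₀ θ t).Config :=
  ⟨h, B, B⟩

theorem exactConfig_injective :
    Function.Injective fun x : List M × Finset (Fin n) =>
      P.exactConfig a q₀ θ t x.1 x.2 := by
  rintro ⟨h, B⟩ ⟨h', B'⟩ hh
  exact Prod.ext (congrArg AdaptiveAdversary.Config.history hh)
    (congrArg AdaptiveAdversary.Config.corrupted hh)

/-! ### The attacked execution dominates the truncated target law -/

variable {P a q₀ θ t}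

theorem recruitCoin_true (hp : AttackParameters a q₀ θ) (h : List M) :
    P.recruitCoin a q₀ θ h true = ENNReal.ofReal (P.recruit a q₀ θ h) := by
  have : ENNReal.ofReal (P.recruit a q₀ θ h) ≤ 1 := by
    simp [recruit_le_one (P := P) hp h]
  simp [recruitCoin, pmfOfTsumEqOne_apply, min_eq_left this]

theorem recruitCoin_false (hp : AttackParameters a q₀ θ) (h : List M) :
    P.recruitCoin a q₀ θ h false = ENNReal.ofReal (1 - P.recruit a q₀ θ h) := by
  have h1 := recruitCoin_true (P := P) hp h
  have h2 := (P.recruitCoin a q₀ θ h).tsum_coe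
  rw [tsum_bool, h1, add_comm] at h2
  rw [ENNReal.ofReal_sub _ (recruit_nonneg hp h), ENNReal.ofReal_one, ← h2,
    ENNReal.add_sub_cancel_left ENNReal.ofReal_ne_top]

/-- As long as at most `t` parties are active, the active and the corrupted parties coincide, so the
cap on corruptions has no effect. -/
theorem le_step_exactConfig (h : List M) (m : M) {B B' : Finset (Fin n)} (ht : B'.card ≤ t) :
    ∑ b : Bool, P.recruitCoin a q₀ θ h b *
        (if (if b then insert (P.speaker h) B else B) = B' then
          (if P.speaker h ∈ B' then P.tilt h (P.bias a q₀ θ h) else P.next h) m else 0) ≤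
      (P.attack a q₀ θ t).step (P.exactConfig a q₀ θ t h B)
        (P.exactConfig a q₀ θ t (h ++ [m]) B') := by
  classical
  refine le_trans (Finset.sum_le_sum fun b _ => mul_le_mul_right ?_ _)
    ((P.attack a q₀ θ t).le_step h m B B' B B' (P.recruitCoin a q₀ θ h) (P.attackMove t h B) rfl)
  by_cases hB : (if b = true then insert (P.speaker h) B else B) = B'
  · exact ((if_pos hB).trans (if_pos (P.attackMove_of_card_le t hB ht)).symm).le
  · rw [if_neg hB]
    exact zero_le

open Classical in
/-- The joint law of the transcript and the active parties: the target law of the transcript, and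
independent parties given the transcript. -/
theorem le_play (hp : AttackParameters a q₀ θ) {k : ℕ} (hk : k ≤ P.rounds) (h : List M)
    {B : Finset (Fin n)} (ht : B.card ≤ t) :
    P.runFrom k [] h * (P.density a θ h *
        ENNReal.ofReal (bernoulliWeight (P.posterior a q₀ θ h) B)) ≤
      (P.attack a q₀ θ t).play k (P.exactConfig a q₀ θ t h B) := by
  induction k generalizing h B with
  | zero =>
    by_cases hh : h = []
    · subst hh
      by_cases hB : B = ∅
      · subst hB
        refine le_trans (b := 1) ?_ (le_of_eq ?_)
        · simp [runFrom, density_nil, posterior_nil, bernoulliWeight]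
        · rw [AdaptiveAdversary.play, PMF.pure_apply]
          exact (if_pos rfl).symm
      · obtain ⟨i, hi⟩ := Finset.nonempty_iff_ne_empty.2 hB
        simp [bernoulliWeight_of_mem hi, posterior_nil]
    · simp [runFrom, hh]
  | succ k ih =>
    rcases List.eq_nil_or_concat h with rfl | ⟨h, m, rfl⟩
    · have : P.runFrom (k + 1) [] [] = 0 := by
        by_contra hc
        simpa using P.length_of_runFrom_ne_zero hc
      simp [this]
    rw [List.concat_eq_append, runFrom_append_singleton]
    by_cases hh : P.runFrom k [] h = 0
    · simp [hh]
    by_cases hm : m ∈ (P.next h).support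
    swap
    · rw [PMF.mem_support_iff, not_not] at hm
      simp [hm]
    have hl := P.length_of_runFrom_ne_zero hh
    obtain ⟨s, hs_def⟩ : ∃ s, P.speaker h = s := ⟨_, rfl⟩
    obtain ⟨q, hq⟩ : ∃ q, P.posterior a q₀ θ h = q := ⟨_, rfl⟩
    obtain ⟨r, hr⟩ : ∃ r, P.recruit a q₀ θ h = r := ⟨_, rfl⟩
    have hq0 : ∀ j, 0 ≤ q j := fun j => hq ▸ (posterior_mem hp h j).1
    have hq1 : ∀ j, q j ≤ 1 := fun j => hq ▸ (posterior_mem hp h j).2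
    have hr0 : 0 ≤ r := hr ▸ recruit_nonneg hp h
    have hr1 : r ≤ 1 := hr ▸ recruit_le_one hp h
    have hdrift := half_le_one_add_drift (a := a) hp hm
    have hbayes := one_add_drift_mul_bayes hp hm
    have hqr := one_sub_mul_recruit (P := P) hp h
    rw [density_append, posterior_append, AdaptiveAdversary.play, PMF.bind_apply]
    rw [hq, hs_def] at hbayes ⊢
    rw [hq, hs_def, hr] at hqr
    -- An active speaker was either active before or just recruited, so two predecessors `B` and
    -- `B.erase s` contribute; an inactive one leaves only `B`.
    by_cases hs : s ∈ B
    · obtain ⟨R, hRdef⟩ : ∃ R, (∏ j ∈ B.erase s, q j) * ∏ j ∈ Bᶜ, (1 - q j) = R := ⟨_, rfl⟩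
      have hR : 0 ≤ R := hRdef ▸ mul_nonneg (Finset.prod_nonneg fun j _ => hq0 j)
        (Finset.prod_nonneg fun j _ => sub_nonneg.2 (hq1 j))
      have hbias := one_add_bias_nonneg hp hm
      have htilt : P.tilt h (P.bias a q₀ θ h) m =
          P.next h m * ENNReal.ofReal (1 + P.bias a q₀ θ h * P.jump h m) :=
        P.tilt_apply (by omega) (fun m hm => one_add_bias_nonneg hp hm) m
      have hcB : P.exactConfig a q₀ θ t h B ≠ P.exactConfig a q₀ θ t h (B.erase s) := by
        intro hc
        have := (Prod.ext_iff.1 (P.exactConfig_injective a q₀ θ t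
          (a₁ := (h, B)) (a₂ := (h, B.erase s)) hc)).2
        exact Finset.erase_ne_self.2 hs this.symm
      refine le_trans ?_ (ENNReal.sum_le_tsum
        {P.exactConfig a q₀ θ t h B, P.exactConfig a q₀ θ t h (B.erase s)})
      rw [Finset.sum_pair hcB]
      have i1 := ih (by omega) h ht
      have i2 := ih (by omega) h (B := B.erase s) ((Finset.card_erase_le).trans ht)
      have j1 := le_step_exactConfig (P := P) (a := a) (q₀ := q₀) (θ := θ) h m (B := B) ht
      have j2 := le_step_exactConfig (P := P) (a := a) (q₀ := q₀) (θ := θ) h m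
        (B := B.erase s) ht
      have hne : B.erase s ≠ B := Finset.erase_ne_self.2 hs
      rw [Fintype.sum_bool] at j1 j2
      simp only [hs_def, hr, if_true, Finset.insert_eq_of_mem hs, Finset.insert_erase hs, hs,
        Bool.false_eq_true, if_false, hne, recruitCoin_true hp, recruitCoin_false hp, htilt,
        mul_zero, add_zero] at j1 j2
      rw [← add_mul, ← ENNReal.ofReal_add hr0 (by linarith), add_sub_cancel, ENNReal.ofReal_one,
        one_mul] at j1
      rw [hq, bernoulliWeight_of_mem hs, hRdef] at i1
      rw [hq, bernoulliWeight_erase hs, hRdef] at i2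
      refine le_trans (le_of_eq ?_) (add_le_add (mul_le_mul' i1 j1) (mul_le_mul' i2 j2))
      rw [bernoulliWeight_update_of_mem hs, hRdef]
      trans P.runFrom k [] h * P.next h m * P.density a θ h *
        ENNReal.ofReal (P.activity a q₀ θ h * (1 + P.bias a q₀ θ h * P.jump h m) * R)
      · rw [← hbayes, mul_assoc (1 + P.drift a θ h * P.jump h m),
          ENNReal.ofReal_mul (p := 1 + P.drift a θ h * P.jump h m) (by linarith)]
        ring
      · have e : P.activity a q₀ θ h * (1 + P.bias a q₀ θ h * P.jump h m) * R =
            q s * R * (1 + P.bias a q₀ θ h * P.jump h m) +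
              (1 - q s) * R * (r * (1 + P.bias a q₀ θ h * P.jump h m)) := by
          linear_combination (-(1 + P.bias a q₀ θ h * P.jump h m) * R) * hqr
        have p1 : 0 ≤ q s * R := mul_nonneg (hq0 s) hR
        have p2 : 0 ≤ (1 - q s) * R := mul_nonneg (sub_nonneg.2 (hq1 s)) hR
        rw [e, ENNReal.ofReal_add (mul_nonneg p1 hbias) (mul_nonneg p2 (mul_nonneg hr0 hbias)),
          ENNReal.ofReal_mul p1, ENNReal.ofReal_mul p2, ENNReal.ofReal_mul hr0]
        ring
    · obtain ⟨R, hRdef⟩ : ∃ R, (∏ j ∈ B, q j) * ∏ j ∈ Bᶜ.erase s, (1 - q j) = R := ⟨_, rfl⟩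
      refine le_trans ?_ (ENNReal.le_tsum (P.exactConfig a q₀ θ t h B))
      have i1 := ih (by omega) h ht
      have j1 := le_step_exactConfig (P := P) (a := a) (q₀ := q₀) (θ := θ) h m (B := B) ht
      have hne : insert s B ≠ B := Finset.insert_ne_self.2 hs
      rw [Fintype.sum_bool] at j1
      simp only [hs_def, hr, if_true, hs, Bool.false_eq_true, if_false, hne, recruitCoin_false hp,
        mul_zero, zero_add] at j1
      rw [hq, bernoulliWeight_of_notMem hs, hRdef] at i1
      refine le_trans (le_of_eq ?_) (mul_le_mul' i1 j1)
      rw [bernoulliWeight_update_of_notMem hs, hRdef]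
      have hact : 0 ≤ 1 - P.activity a q₀ θ h := sub_nonneg.2 (activity_le_one hp h)
      trans P.runFrom k [] h * P.next h m * P.density a θ h *
        ENNReal.ofReal ((1 - P.activity a q₀ θ h) * R)
      · have e : (1 - P.activity a q₀ θ h) * R = (1 + P.drift a θ h * P.jump h m) *
            ((1 - P.bayes a q₀ θ h m (q s)) * R) := by
          linear_combination R * hbayes + R * P.jump h m * activity_mul_bias (P := P) hp h
        rw [e, ENNReal.ofReal_mul (p := 1 + P.drift a θ h * P.jump h m) (by linarith)]
        ring
      · have e : (1 - P.activity a q₀ θ h) * R = (1 - q s) * R * (1 - r) := by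
          linear_combination R * hqr
        rw [e, ENNReal.ofReal_mul' (sub_nonneg.2 hr1)]
        ring

/-- The expected outcome of the attack. -/
theorem le_expectedOutcome_attack (hp : AttackParameters a q₀ θ) (hq : n * q₀ ^ 2 = 1) {δ : ℝ}
    (hδ : (P.transcript.toOuterMeasure
      {t | ∃ i < P.rounds,
        (P.jumpSupport (t.take i) ∩ Set.Iic (-θ)).Nonempty}).toReal ≤ δ) :
    1 - (Real.exp (-(a * P.expectedOutcome)) + Real.exp a * δ) - (2 + a) / q₀ / (t + 1) ≤
      (P.attack a q₀ θ t).expectedOutcome := by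
  classical
  have hδ0 : 0 ≤ δ := ENNReal.toReal_nonneg.trans hδ
  have hq0 := hp.initial_pos
  have ha := hp.pos
  have hlow : ∑' h, (if P.output h = true then P.transcript h * (P.density a θ h *
      ENNReal.ofReal (1 - (∑ j, P.posterior a q₀ θ h j) / (t + 1))) else 0) ≤
      (((P.attack a q₀ θ t).play P.rounds).map fun c => P.output c.history) true := by
    rw [PMF.map_apply]
    -- All snapshots other than the exact ones are discarded.
    refine le_trans ?_ (ENNReal.tsum_comp_le_tsum_of_injective
      (P.exactConfig_injective a q₀ θ t) _)
    rw [ENNReal.tsum_prod']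
    refine ENNReal.tsum_le_tsum fun h => ?_
    by_cases ho : P.output h = true
    swap
    · simp [ho]
    rw [if_pos ho, tsum_fintype]
    calc
      _ ≤ ∑ B : Finset (Fin n) with B.card ≤ t, P.transcript h * (P.density a θ h *
          ENNReal.ofReal (bernoulliWeight (P.posterior a q₀ θ h) B)) := by
        rw [← Finset.mul_sum, ← Finset.mul_sum, ← ENNReal.ofReal_sum_of_nonneg fun B _ =>
          bernoulliWeight_nonneg (fun j => (posterior_mem hp h j).1)
            (fun j => (posterior_mem hp h j).2) B]
        gcongr
        exact one_sub_le_sum_bernoulliWeight (fun j => (posterior_mem hp h j).1)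
            (fun j => (posterior_mem hp h j).2) t
      _ ≤ _ := by
        rw [Finset.sum_filter]
        refine Finset.sum_le_sum fun B _ => ?_
        split_ifs with h1 h2
        · exact le_play hp le_rfl h h1
        · exact absurd ho.symm h2
        · exact zero_le
        · exact zero_le
  -- The unit mass of the target law splits into output `0`, output `1` with at most `t` active
  -- parties, and the Markov error.
  have hsplit : (1 : ℝ≥0∞) ≤
      (((P.attack a q₀ θ t).play P.rounds).map fun c => P.output c.history) true +
        (ENNReal.ofReal (Real.exp (-(a * P.expectedOutcome)) + Real.exp a * δ) +
          ENNReal.ofReal ((2 + a) / q₀) * ENNReal.ofReal (1 / (t + 1))) := by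
    rw [← tsum_density hp (le_refl P.rounds)]
    refine le_trans ?_ (add_le_add hlow (add_le_add (tsum_density_output_false_le hp hδ)
      (mul_le_mul_left (tsum_density_mul_sum_posterior_le (P := P) hp hq) _)))
    rw [← ENNReal.tsum_mul_right, ← ENNReal.tsum_add, ← ENNReal.tsum_add]
    refine ENNReal.tsum_le_tsum fun h => ?_
    have hS : 0 ≤ ∑ j, P.posterior a q₀ θ h j :=
      Finset.sum_nonneg fun j _ => (posterior_mem hp h j).1
    have hS' : ENNReal.ofReal (∑ j, P.posterior a q₀ θ h j) * ENNReal.ofReal (1 / (t + 1)) =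
        ENNReal.ofReal ((∑ j, P.posterior a q₀ θ h j) / (t + 1)) := by
      rw [← ENNReal.ofReal_mul hS, mul_one_div]
    have hS1 : (1 : ℝ≥0∞) ≤ ENNReal.ofReal (1 - (∑ j, P.posterior a q₀ θ h j) / (t + 1)) +
        ENNReal.ofReal ((∑ j, P.posterior a q₀ θ h j) / (t + 1)) := by
      rw [← ENNReal.ofReal_one]
      exact (ENNReal.ofReal_le_ofReal (by linarith)).trans ENNReal.ofReal_add_le
    change P.transcript h * P.density a θ h ≤ _
    rw [mul_assoc (P.transcript h), mul_assoc (P.density a θ h), hS']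
    cases ho : P.output h
    · simp only [Bool.false_eq_true, if_true, if_false, zero_add]
      exact le_self_add
    · simp only [Bool.true_eq_false, if_true, if_false, zero_add]
      rw [← mul_add, ← mul_add]
      exact mul_le_mul_right (le_mul_of_one_le_right' hS1) _
  have hpos : 0 ≤ Real.exp (-(a * P.expectedOutcome)) + Real.exp a * δ := by positivity
  rw [← ENNReal.ofReal_mul (by positivity), mul_one_div, ← ENNReal.ofReal_add hpos (by positivity),
    ← ENNReal.ofReal_toReal (PMF.apply_ne_top _ true),
    ← ENNReal.ofReal_add ENNReal.toReal_nonneg (by positivity), ENNReal.one_le_ofReal] at hsplit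
  unfold AdaptiveAdversary.expectedOutcome
  linarith

end CoinFlipProtocol

/-! ### The parameters -/

/-- Here `2 ^ L` plays the role of `log n`. It exceeds both `exp (1 / ε ^ 2)` and `1 / ε ^ 50`, so
the three errors are at most `ε`, `ε` and `3 * ε`. -/
theorem coin_error_le {ε L : ℝ} (hε : 0 < ε) (hε' : ε ≤ 1 / 10) (hL : L = 1 / ε ^ 50) :
    Real.exp (-(1 / ε ^ 2 * ε)) + Real.exp (1 / ε ^ 2) * (1 / ((2 : ℝ) ^ L) ^ 2) +
      (2 + 1 / ε ^ 2) / (2 : ℝ) ^ L ≤ 10 * ε := by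
  have hε1 : ε ≤ 1 := by linarith
  have hpow : ∀ k, k ≠ 0 → ε ^ k ≤ ε := fun k hk => pow_le_of_le_one hε.le hε1 hk
  have hY : 1 / ε ^ 50 ≤ (2 : ℝ) ^ L := by
    have h1 : 1 ≤ L := by
      rw [hL]
      exact one_le_one_div (by positivity) (pow_le_one₀ hε.le hε1)
    have := one_add_mul_self_le_rpow_one_add (s := 1) (by norm_num) h1
    norm_num at this
    rw [← hL]
    linarith
  have hexp : Real.exp (1 / ε ^ 2) ≤ (2 : ℝ) ^ L := by
    rw [Real.rpow_def_of_pos two_pos, Real.exp_le_exp]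
    have h1 : L = 1 / ε ^ 2 * (1 / ε ^ 48) := by rw [hL]; field_simp
    have h2 : 2 ≤ 1 / ε ^ 48 := by
      rw [le_div_iff₀ (by positivity)]
      linarith [hpow 48 (by norm_num)]
    have h3 : 0 < 1 / ε ^ 2 := by positivity
    have h4 : 1 / ε ^ 2 * 2 ≤ L := h1 ▸ mul_le_mul_of_nonneg_left h2 h3.le
    nlinarith [Real.log_two_gt_d9]
  have hYpos : 0 < (2 : ℝ) ^ L := by positivity
  have hinv : 1 / (2 : ℝ) ^ L ≤ ε ^ 50 := by
    rw [div_le_iff₀ hYpos]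
    rwa [div_le_iff₀' (by positivity)] at hY
  have e1 : Real.exp (-(1 / ε ^ 2 * ε)) ≤ ε := by
    have h1 : 1 / ε ^ 2 * ε = 1 / ε := by field_simp
    rw [h1, Real.exp_neg, inv_le_comm₀ (Real.exp_pos _) hε, ← one_div]
    linarith [Real.add_one_le_exp (1 / ε)]
  have e2 : Real.exp (1 / ε ^ 2) * (1 / ((2 : ℝ) ^ L) ^ 2) ≤ ε := by
    calc _ ≤ (2 : ℝ) ^ L * (1 / ((2 : ℝ) ^ L) ^ 2) := by gcongr
      _ = 1 / (2 : ℝ) ^ L := by field_simp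
      _ ≤ ε := hinv.trans (hpow 50 (by norm_num))
  have e3 : (2 + 1 / ε ^ 2) / (2 : ℝ) ^ L ≤ 3 * ε := by
    calc _ = (2 + 1 / ε ^ 2) * (1 / (2 : ℝ) ^ L) := by ring
      _ ≤ (2 + 1 / ε ^ 2) * ε ^ 50 := by gcongr
      _ = 2 * ε ^ 50 + ε ^ 48 := by field_simp
      _ ≤ 3 * ε := by linarith [hpow 50 (by norm_num), hpow 48 (by norm_num)]
  linarith

theorem one_lt_logb_two_natCast {n : ℕ} (hn : 3 ≤ n) : 1 < Real.logb 2 (n : ℝ) := by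
  have : (3 : ℝ) ≤ n := by exact_mod_cast hn
  rw [Real.lt_logb_iff_rpow_lt (by norm_num) (by linarith)]
  norm_num
  linarith

theorem coinEps_pos {n : ℕ} (hn : 3 ≤ n) : 0 < coinEps n :=
  one_div_pos.2 (Real.rpow_pos_of_pos
    (Real.logb_pos (by norm_num) (one_lt_logb_two_natCast hn)) _)

theorem logb_logb_eq_one_div_coinEps_pow {n : ℕ} (hn : 3 ≤ n) :
    Real.logb 2 (Real.logb 2 (n : ℝ)) = 1 / coinEps n ^ 50 := by
  have h := Real.logb_pos (b := 2) (by norm_num) (one_lt_logb_two_natCast hn)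
  rw [coinEps, one_div_pow, one_div_one_div, ← Real.rpow_natCast, ← Real.rpow_mul h.le]
  norm_num

/-- With `λ = 100 / ε ^ 5`, the quantity `2aθ` equals `(ε ^ 3 / 50) * q₀`, well below `q₀`. -/
theorem attackParameters_coin {n : ℕ} (hn : 3 ≤ n) (hε : coinEps n ≤ 1 / 10) :
    CoinFlipProtocol.AttackParameters (1 / coinEps n ^ 2) (1 / √(n : ℝ)) (1 / (coinLambda n * √(n : ℝ))) := by
  have hpos := coinEps_pos hn
  have hn1 : (1 : ℝ) ≤ n := by exact_mod_cast (by omega : 1 ≤ n)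
  have hs : 1 ≤ √(n : ℝ) := Real.one_le_sqrt.2 hn1
  have hs0 : 0 < √(n : ℝ) := by linarith
  refine ⟨by positivity, by positivity, (div_le_one hs0).2 hs, ?_⟩
  have e : 2 * (1 / coinEps n ^ 2) * (1 / (coinLambda n * √(n : ℝ))) =
      coinEps n ^ 3 / 50 * (1 / √(n : ℝ)) := by
    unfold coinLambda
    field_simp
    norm_num
  rw [e]
  refine mul_le_of_le_one_left (by positivity) ?_
  linarith [pow_le_one₀ (n := 3) hpos.le (by linarith : coinEps n ≤ 1)]

/-! ### Conclusion -/

theorem mainTheorem2 :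
    ∃ c₁ c₂ : ℝ, 0 < c₁ ∧ 0 < c₂ ∧
      ∀ (n : ℕ), 3 ≤ n → ∀ (M : Type*) (P : CoinFlipProtocol n M),
        P.IsRobust n → coinEps n ≤ P.expectedOutcome →
        ∃ (t : ℕ) (A : AdaptiveAdversary P),
          (t : ℝ) ≤ c₁ * Real.sqrt (n : ℝ) * Real.logb 2 (n : ℝ) ∧
          A.IsAdaptive t ∧
          1 - c₂ * coinEps n ≤ A.expectedOutcome := by
  refine ⟨1, 10, one_pos, by norm_num, fun n hn M P hrob hP => ?_⟩
  have hlog := one_lt_logb_two_natCast hn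
  have hε := coinEps_pos hn
  have hs : 0 < √(n : ℝ) := Real.sqrt_pos.2 (by exact_mod_cast (by omega : 0 < n))
  set t := ⌊√(n : ℝ) * Real.logb 2 (n : ℝ)⌋₊
  refine ⟨t, P.attack (1 / coinEps n ^ 2) (1 / √(n : ℝ)) (1 / (coinLambda n * √(n : ℝ))) t, ?_,
    P.attack_isAdaptive _ _ _ t, ?_⟩
  · rw [one_mul]
    exact Nat.floor_le (by positivity)
  rcases le_or_gt (coinEps n) (1 / 10) with hε' | hε'
  swap
  -- For `ε > 1 / 10` the claimed bound `1 - 10 * ε` is negative.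
  · exact le_trans (by linarith) ENNReal.toReal_nonneg
  have hq : n * (1 / √(n : ℝ)) ^ 2 = 1 := by
    rw [one_div_pow, Real.sq_sqrt (Nat.cast_nonneg n), mul_one_div, div_self]
    exact_mod_cast (by omega : n ≠ 0)
  have key := CoinFlipProtocol.le_expectedOutcome_attack (t := t)
    (attackParameters_coin hn hε') hq hrob
  refine le_trans ?_ key
  have hexp : (2 : ℝ) ^ Real.logb 2 (Real.logb 2 (n : ℝ)) = Real.logb 2 (n : ℝ) :=
    Real.rpow_logb two_pos (by norm_num) (by linarith)
  have herr := coin_error_le hε hε' (logb_logb_eq_one_div_coinEps_pow hn)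
  rw [hexp] at herr
  have h1 : Real.exp (-(1 / coinEps n ^ 2 * P.expectedOutcome)) ≤
      Real.exp (-(1 / coinEps n ^ 2 * coinEps n)) := by
    gcongr
  have h2 : (2 + 1 / coinEps n ^ 2) / (1 / √(n : ℝ)) / (t + 1) ≤
      (2 + 1 / coinEps n ^ 2) / Real.logb 2 (n : ℝ) := by
    have ht : √(n : ℝ) * Real.logb 2 (n : ℝ) ≤ t + 1 := (Nat.lt_floor_add_one _).le
    rw [div_div]
    refine div_le_div_of_nonneg_left (by positivity) (by linarith) ?_
    rw [one_div_mul_eq_div, le_div_iff₀' hs]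
    exact ht
  rw [coinDelta]
  linarith
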